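/- Throughout, Euclidean norms and inner products are used. Let $[t_0,t_1]$ be a compact interval, let $U\subseteq\mathbb R^m$ be closed, and let $g:\mathbb R^n\times\mathbb R^m\to\mathbb R^{l_1}$, $h:\mathbb R^n\times\mathbb R^m\to\mathbb R^{l_2}$ and $G,H:\mathbb R^n\times\mathbb R^m\to\mathbb R^{l}$ be strictly differentiable at every point (autonomous data). Put $$S:=\{(x,u)\in\mathbb R^n\times U:\ g(x,u)\le 0,\ h(x,u)=0,\ 0\le G(x,u)\perp H(x,u)\ge 0\}.$$ For $\Omega\subseteq\mathbb R^d$ and $z\in\mathrm{cl}\,\Omega$ let $\mathcal N^P_\Omega(z)$ be the proximal normal cone, the set of all $v$ for which there is $\sigma\ge0$ with $\langle v,y-z\rangle\le\sigma\|y-z\|^2$ for all $y\in\Omega$, and let $\mathcal N^L_\Omega(z)$ be the limiting normal cone, the set of all limits of sequences $v^k\in\mathcal N^P_\Omega(z^k)$ with $z^k\in \mathrm{cl}\,\Omega$, $z^k\to z$. Let $x^*:[t_0,t_1]\to\mathbb R^n$, $u^*:[t_0,t_1]\to\mathbb R^m$ (the reference process) and $R:[t_0,t_1]\to[0,+\infty]$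 be functions, let $\epsilon>0$, and put $$S_*^{\epsilon,R}(t):=\{(x,u)\in S:\ \|x-x^*(t)\|\le\epsilon,\ \|u-u^*(t)\|\le R(t)\},$$ $$C_*^{\epsilon,R}:=\mathrm{cl}\,\{(t,x,u)\in[t_0,t_1]\times\mathbb R^n\times\mathbb R^m:\ (x,u)\in S_*^{\epsilon,R}(t)\}.$$ For $(\lambda,\upsilon,\mu,\nu)\in\mathbb R^{l_1}\times\mathbb R^{l_2}\times\mathbb R^l\times\mathbb R^l$ let $$\Psi(x,u;\lambda,\upsilon,\mu,\nu):=g(x,u)^\top\lambda+h(x,u)^\top\upsilon-G(x,u)^\top\mu-H(x,u)^\top\nu .$$ Assume that $C_*^{\epsilon,R}$ is compact and that for every $(x,u)$ such that $(t,x,u)\in C_*^{\epsilon,R}$ for some $t$, the following holds: whenever $(\lambda,\upsilon,\mu,\nu)$ satisfies - $0\in\nabla_u\Psi(x,u;\lambda,\upsilon,\mu,\nu)+\mathcal N^L_U(u)$, - $\lambda\ge0$, and $\lambda_i=0$ if $g_i(x,u)<0$, - $\mu_i=0$ if $G_i(x,u)>0=H_i(x,u)$, and $\nu_i=0$ if $G_i(x,u)=0<H_i(x,u)$,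 - $\mu_i>0,\ \nu_i>0$ or $\mu_i\nu_i=0$, if $G_i(x,u)=0=H_i(x,u)$, then $(\lambda,\upsilon,\mu,\nu)=0$. Then there is a constant $\pi>0$ such that for every $t\in[t_0,t_1]$ the bounded slope condition holds with $k_S(t)=\pi$: $$(x,u)\in S_*^{\epsilon,R}(t),\ (\alpha,\beta)\in\mathcal N^P_S(x,u)\ \Longrightarrow\ \|\alpha\|\le \pi\,\|\beta\|.$$ -/

import Mathlib

open Filter Topology Set
open scoped ENNReal

noncomputable section

namespace OCPEC

/-- The Euclidean space of dimension `n`. -/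
abbrev Euc (n : ℕ) : Type := EuclideanSpace ℝ (Fin n)

/-- The proximal normal cone to `Ω` at `x`; it is empty if `x` is not in the closure of `Ω`. -/
def proximalNormalCone {V : Type*} [NormedAddCommGroup V] [InnerProductSpace ℝ V]
    (Ω : Set V) (x : V) : Set V :=
  {v | x ∈ closure Ω ∧ ∃ σ : ℝ, 0 ≤ σ ∧ ∀ y ∈ Ω, inner ℝ v (y - x) ≤ σ * ‖y - x‖ ^ 2}

/-- The limiting (Mordukhovich) normal cone to `Ω` at `x`: limits of proximal normals at points
of the closure of `Ω` converging to `x`. -/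
def limitingNormalCone {V : Type*} [NormedAddCommGroup V] [InnerProductSpace ℝ V]
    (Ω : Set V) (x : V) : Set V :=
  {v | ∃ (xs vs : ℕ → V), Tendsto xs atTop (𝓝 x) ∧ Tendsto vs atTop (𝓝 v) ∧
    ∀ k, vs k ∈ proximalNormalCone Ω (xs k)}

/-- The complementarity cone `{(a, b) : 0 ≤ a ⊥ b ≥ 0}`. -/
def complementarityCone (l : ℕ) : Set (Euc l × Euc l) :=
  {p | (∀ i, 0 ≤ p.1 i) ∧ (∀ i, 0 ≤ p.2 i) ∧ inner ℝ p.1 p.2 = 0}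

/-- The mixed constraint set `{(x, u) : u ∈ U, g ≤ 0, h = 0, 0 ≤ G ⊥ H ≥ 0}`. -/
def constraintSet {n m l₁ l₂ l : ℕ} (U : Set (Euc m)) (g : Euc n × Euc m → Euc l₁)
    (h : Euc n × Euc m → Euc l₂) (G H : Euc n × Euc m → Euc l) : Set (Euc n × Euc m) :=
  {z | z.2 ∈ U ∧ (∀ i, g z i ≤ 0) ∧ h z = 0 ∧ (G z, H z) ∈ complementarityCone l}

/-- The part `S_*^{ε,R}(t)` of `S(t)` that lies around the reference point `(x^*(t), u^*(t))`.
The radius `R t` may be `∞`. -/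
def localSet {n m : ℕ} (S : ℝ → Set (Euc n × Euc m)) (xstar : ℝ → Euc n) (ustar : ℝ → Euc m)
    (ε : ℝ) (R : ℝ → ℝ≥0∞) (t : ℝ) : Set (Euc n × Euc m) :=
  {z | z ∈ S t ∧ ‖z.1 - xstar t‖ ≤ ε ∧ ENNReal.ofReal ‖z.2 - ustar t‖ ≤ R t}

/-- The set `C_*^{ε,R}`: the closure of the set of all `(t, x, u)` with `t ∈ [t₀, t₁]` and
`(x, u) ∈ S_*^{ε,R}(t)`. -/
def localTube {n m : ℕ} (t₀ t₁ : ℝ) (S : ℝ → Set (Euc n × Euc m)) (xstar : ℝ → Euc n)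
    (ustar : ℝ → Euc m) (ε : ℝ) (R : ℝ → ℝ≥0∞) : Set (ℝ × Euc n × Euc m) :=
  closure {p | p.1 ∈ Icc t₀ t₁ ∧ p.2 ∈ localSet S xstar ustar ε R p.1}

/-- The bounded slope condition at time `t` with slope function `kS`. Normals to `S(t)` are taken
for the Euclidean structure of the product, hence the passage through `WithLp 2`. -/
def BoundedSlope {n m : ℕ} (S : ℝ → Set (Euc n × Euc m)) (xstar : ℝ → Euc n)
    (ustar : ℝ → Euc m) (ε : ℝ) (R : ℝ → ℝ≥0∞) (kS : ℝ → ℝ) (t : ℝ) : Prop :=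
  ∀ (x : Euc n) (u : Euc m), (x, u) ∈ localSet S xstar ustar ε R t →
    ∀ (α : Euc n) (β : Euc m),
      WithLp.toLp 2 (α, β) ∈
        proximalNormalCone (V := WithLp 2 (Euc n × Euc m)) (WithLp.ofLp ⁻¹' S t)
          (WithLp.toLp 2 (x, u)) →
      ‖α‖ ≤ kS t * ‖β‖

/-- The function `Ψ(x, u; lam, υ, μ, ν) = gᵀ lam + hᵀ υ - Gᵀ μ - Hᵀ ν`. -/
def Psi {n m l₁ l₂ l : ℕ} (g : Euc n × Euc m → Euc l₁) (h : Euc n × Euc m → Euc l₂)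
    (G H : Euc n × Euc m → Euc l) (lam : Euc l₁) (υ : Euc l₂) (μ ν : Euc l)
    (x : Euc n) (u : Euc m) : ℝ :=
  inner ℝ (g (x, u)) lam + inner ℝ (h (x, u)) υ - inner ℝ (G (x, u)) μ - inner ℝ (H (x, u)) ν

/-- The condition of Mangasarian-Fromovitz type at `(x, u)`: the only multiplier with
`0 ∈ ∇_u Ψ + N_U(u)` and M-type signs is zero. -/
def MFCondition {n m l₁ l₂ l : ℕ} (U : Set (Euc m)) (g : Euc n × Euc m → Euc l₁)
    (h : Euc n × Euc m → Euc l₂) (G H : Euc n × Euc m → Euc l) (x : Euc n) (u : Euc m) : Prop :=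
  ∀ (lam : Euc l₁) (υ : Euc l₂) (μ ν : Euc l),
    (∃ ζ ∈ limitingNormalCone U u, gradient (Psi g h G H lam υ μ ν x) u + ζ = 0) →
    (∀ i, 0 ≤ lam i) →
    (∀ i, g (x, u) i < 0 → lam i = 0) →
    (∀ i, 0 < G (x, u) i → H (x, u) i = 0 → μ i = 0) →
    (∀ i, G (x, u) i = 0 → 0 < H (x, u) i → ν i = 0) →
    (∀ i, G (x, u) i = 0 → H (x, u) i = 0 → (0 < μ i ∧ 0 < ν i) ∨ μ i * ν i = 0) →
    lam = 0 ∧ υ = 0 ∧ μ = 0 ∧ ν = 0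

/-- Strict differentiability at every point. -/
def StrictlyDifferentiable {n m k : ℕ} (f : Euc n × Euc m → Euc k) : Prop :=
  ∀ z, ∃ f' : (Euc n × Euc m) →L[ℝ] Euc k, HasStrictFDerivAt f f' z

end OCPEC

end

/-! Write the constraints as `u ∈ U`, `F (x, u) ∈ Θ`, where `F = (g, h, G, H)` and `Θ` is the closed
set of admissible values. Every proximal normal `(α, β)` to this system can be approximated by a
multiplier: for nearby points, some `mult` proximal normal to `Θ` satisfies `α ≈ F_xᵀ mult`, and `β'
- F_uᵀ mult` is a proximal normal to `U` for some `β' ≈ β` (`exists_approximate_multiplier`). This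
comes from minimizing a quadratic penalty in which `F (x, u)` is decoupled from a free variable `w ∈
Θ`; it needs no constraint qualification.

The slope bound is then a compactness argument (`exists_slope_bound`). If it failed, normals with
`‖α‖ = 1` and `β → 0` would exist. After rescaling, their multipliers converge to a limiting normal
`Λ` of `Θ` with `-F_uᵀ Λ` a limiting normal to `U`. The qualification forces `Λ = 0`, hence `α → 0`,
a contradiction.

Limiting normals to `Θ` carry the M-type signs (`limiting_signs`), so the Mangasarian-Fromovitz
condition gives this qualification. The data are autonomous, so one compact set of pairs `(x, u)`
serves all times and the constant is uniform. -/

namespace OCPEC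

/-! ### Proximal and regular normals -/

section NormalCones

variable {V : Type*} [NormedAddCommGroup V] [InnerProductSpace ℝ V]

theorem smul_mem_proximalNormalCone {Ω : Set V} {x v : V} {c : ℝ} (hc : 0 ≤ c)
    (hv : v ∈ proximalNormalCone Ω x) : c • v ∈ proximalNormalCone Ω x := by
  obtain ⟨hx, σ, hσ, h⟩ := hv
  refine ⟨hx, c * σ, mul_nonneg hc hσ, fun y hy => ?_⟩
  rw [inner_smul_left, mul_assoc]
  exact mul_le_mul_of_nonneg_left (h y hy) hc

/-- Nearest points produce proximal normals. -/
theorem smul_sub_mem_proximalNormalCone {Ω : Set V} {p q : V} (hp : p ∈ Ω)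
    (h : ∀ y ∈ Ω, ‖q - p‖ ≤ ‖q - y‖) {c : ℝ} (hc : 0 ≤ c) :
    c • (q - p) ∈ proximalNormalCone Ω p := by
  refine smul_mem_proximalNormalCone hc
    ⟨subset_closure hp, 1 / 2, by norm_num, fun y hy => ?_⟩
  have h1 : ‖q - p‖ ^ 2 ≤ ‖q - y‖ ^ 2 := pow_le_pow_left₀ (norm_nonneg _) (h y hy) 2
  have h2 : q - y = (q - p) - (y - p) := by abel
  rw [h2, norm_sub_sq_real (q - p) (y - p)] at h1
  linarith

/-- A regular (Fréchet) normal is approximated by proximal normals at nearby points. -/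
theorem exists_proximalNormal_near [ProperSpace V] {Ω : Set V} (hΩ : IsClosed Ω) {x v : V}
    (hx : x ∈ Ω) (hv : ∀ c > 0, ∀ᶠ y in 𝓝[Ω] x, inner ℝ v (y - x) ≤ c * ‖y - x‖)
    {δ : ℝ} (hδ : 0 < δ) :
    ∃ x' v', v' ∈ proximalNormalCone Ω x' ∧ ‖x' - x‖ < δ ∧ ‖v' - v‖ < δ := by
  obtain ⟨r, hr, hball⟩ := Metric.mem_nhdsWithin_iff.1 (hv (δ / 4) (by positivity))
  -- The projection `p` of `x + t • v` onto `Ω` lies within `2 * t * ‖v‖` of `x`; this `t` keeps it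
  -- both in the ball where `hv` applies and within `δ`.
  obtain ⟨t, ht, htr, htδ⟩ : ∃ t : ℝ, 0 < t ∧ 2 * t * ‖v‖ < r ∧ 2 * t * ‖v‖ < δ := by
    have hN : 0 < 2 * ‖v‖ + 1 := by positivity
    have hm : 0 < min r δ := lt_min hr hδ
    have key : 2 * (min r δ / (2 * ‖v‖ + 1)) * ‖v‖ < min r δ := by
      have h1 : 2 * (min r δ / (2 * ‖v‖ + 1)) * ‖v‖ = min r δ * (2 * ‖v‖ / (2 * ‖v‖ + 1)) := by
        ring
      rw [h1]
      exact mul_lt_of_lt_one_right hm ((div_lt_one hN).2 (by linarith))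
    exact ⟨min r δ / (2 * ‖v‖ + 1), by positivity, key.trans_le (min_le_left _ _),
      key.trans_le (min_le_right _ _)⟩
  obtain ⟨p, hp, hpd⟩ := hΩ.exists_infDist_eq_dist ⟨x, hx⟩ (x + t • v)
  have hmin : ∀ y ∈ Ω, ‖(x + t • v) - p‖ ≤ ‖(x + t • v) - y‖ := fun y hy => by
    rw [← dist_eq_norm, ← dist_eq_norm, ← hpd]
    exact Metric.infDist_le_dist_of_mem hy
  have htv : ‖t • v‖ = t * ‖v‖ := by rw [norm_smul, Real.norm_of_nonneg ht.le]
  have h1 : ‖(x + t • v) - p‖ ≤ t * ‖v‖ := by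
    have := hmin x hx
    rwa [add_sub_cancel_left, htv] at this
  have e1 : (x + t • v) - p = t • v - (p - x) := by abel
  have h2 : ‖p - x‖ ≤ 2 * t * ‖v‖ := by
    have e2 : p - x = t • v - ((x + t • v) - p) := by abel
    rw [e2]
    refine (norm_sub_le _ _).trans ?_
    linarith
  have h3 : inner ℝ v (p - x) ≤ δ / 4 * ‖p - x‖ :=
    hball ⟨by rw [Metric.mem_ball, dist_eq_norm]; linarith, hp⟩
  -- Expand the square in `‖t • v - (p - x)‖ ≤ ‖t • v‖`. With `h3` this gives `‖p - x‖ ≤ t * δ / 2`,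
  -- so the normal `t⁻¹ • (x + t • v - p)` differs from `v` by at most `δ / 2`.
  have h4 : ‖p - x‖ ^ 2 ≤ 2 * t * inner ℝ v (p - x) := by
    have h5 := pow_le_pow_left₀ (norm_nonneg _) h1 2
    rw [e1, norm_sub_sq_real, htv, inner_smul_left] at h5
    simp only [conj_trivial] at h5
    linarith
  have h5 : ‖p - x‖ ≤ t * (δ / 2) := by
    by_contra! hlt
    have : 2 * t * inner ℝ v (p - x) ≤ 2 * t * (δ / 4 * ‖p - x‖) :=
      mul_le_mul_of_nonneg_left h3 (by positivity)
    have hpos : 0 < ‖p - x‖ := lt_trans (by positivity) hlt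
    nlinarith
  refine ⟨p, t⁻¹ • ((x + t • v) - p),
    smul_sub_mem_proximalNormalCone hp hmin (inv_nonneg.2 ht.le), h2.trans_lt htδ, ?_⟩
  have e3 : t⁻¹ • ((x + t • v) - p) - v = -(t⁻¹ • (p - x)) := by
    rw [e1, smul_sub, inv_smul_smul₀ ht.ne']
    abel
  rw [e3, norm_neg, norm_smul, Real.norm_of_nonneg (inv_nonneg.2 ht.le)]
  calc t⁻¹ * ‖p - x‖ ≤ t⁻¹ * (t * (δ / 2)) :=
        mul_le_mul_of_nonneg_left h5 (inv_nonneg.2 ht.le)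
    _ = δ / 2 := by rw [inv_mul_cancel_left₀ ht.ne']
    _ < δ := by linarith

/-- First-order necessary condition: at a minimizer over `Ω`, minus the gradient is a regular
normal. -/
theorem eventually_inner_le_of_isMinOn [CompleteSpace V] {Ω : Set V} {f : V → ℝ} {x v : V}
    (hmin : ∀ y ∈ Ω, f x ≤ f y) (hf : HasGradientAt f (-v) x) :
    ∀ c > 0, ∀ᶠ y in 𝓝[Ω] x, inner ℝ v (y - x) ≤ c * ‖y - x‖ := by
  intro c hc
  have h1 := (hasGradientAt_iff_isLittleO.1 hf).def hc
  filter_upwards [nhdsWithin_le_nhds h1, self_mem_nhdsWithin] with y hy hyΩ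
  have h2 := le_of_abs_le hy
  rw [inner_neg_left] at h2
  have h3 := neg_le_of_abs_le hy
  have h4 := hmin y hyΩ
  rw [inner_neg_left] at h3
  linarith

end NormalCones

/-- At a point of strict differentiability the derivative depends continuously on the point. -/
theorem continuousAt_fderiv_of_hasStrictFDerivAt {E F : Type*} [NormedAddCommGroup E]
    [NormedSpace ℝ E] [NormedAddCommGroup F] [NormedSpace ℝ F] {f : E → F} {f' : E →L[ℝ] F}
    {x : E} (hf : HasStrictFDerivAt f f' x) (hd : Differentiable ℝ f) :
    ContinuousAt (fderiv ℝ f) x := by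
  rw [Metric.continuousAt_iff']
  intro c hc
  obtain ⟨s, hs, hlip⟩ := hf.approximates_deriv_on_nhds
    (c := ⟨c / 2, by positivity⟩) (Or.inr (by exact_mod_cast (half_pos hc)))
  rw [hf.hasFDerivAt.fderiv]
  filter_upwards [eventually_mem_nhds_iff.2 hs] with y hy
  -- Near `x` the map `f - f'` is Lipschitz with constant `c / 2`, which bounds the norm of its
  -- derivative at `y`.
  have h1 : HasFDerivAt (fun z => f z - f' z) (fderiv ℝ f y - f') y :=
    (hd y).hasFDerivAt.sub f'.hasFDerivAt
  have h2 := h1.le_of_lipschitzOn hy hlip.lipschitzOnWith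
  rw [dist_eq_norm]
  refine lt_of_le_of_lt h2 ?_
  change c / 2 < c
  linarith

/-! ### Penalty functions: existence and localization of minimizers -/

section Penalty

variable {X Y W : Type*} [NormedAddCommGroup X] [InnerProductSpace ℝ X]
  [NormedAddCommGroup Y] [InnerProductSpace ℝ Y] [NormedAddCommGroup W]

/-- Quadratic penalty function for testing a proximal normal `(α, β)` at `(a, b)` to
`{(x, u) | u ∈ U, F (x, u) ∈ Θ}`. -/
noncomputable def penalty (F : X × Y → W) (a : X) (b : Y) (α : X) (β : Y) (σ ρ : ℝ) (x : X)
    (u : Y) (w : W) : ℝ :=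
  (σ + 1) * (‖x - a‖ ^ 2 + ‖u - b‖ ^ 2) - (inner ℝ α (x - a) + inner ℝ β (u - b)) +
    ρ * ‖F (x, u) - w‖ ^ 2

/-- Since `σ + 1 ≥ 1`, the quadratic terms are dominated by the linear ones: `X² + Y² + T ≤ A X + B
Y`. The bounds on `x` and `u` depend on neither `σ` nor `ρ`, so a single compact set serves all
penalty parameters. -/
theorem bounds_of_penalty_nonpos {F : X × Y → W} {a : X} {b : Y} {α : X} {β : Y} {σ ρ : ℝ}
    (hσ : 0 ≤ σ) (hρ : 0 < ρ) {x : X} {u : Y} {w : W} (h : penalty F a b α β σ ρ x u w ≤ 0) :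
    ‖x - a‖ ≤ ‖α‖ + ‖β‖ ∧ ‖u - b‖ ≤ ‖α‖ + ‖β‖ ∧
      ‖F (x, u) - w‖ ^ 2 ≤ (‖α‖ + ‖β‖) ^ 2 / ρ := by
  rw [le_div_iff₀' hρ]
  have h1 := real_inner_le_norm α (x - a)
  have h2 := real_inner_le_norm β (u - b)
  unfold penalty at h
  have hα := norm_nonneg α
  have hβ := norm_nonneg β
  have hx := norm_nonneg (x - a)
  have hu := norm_nonneg (u - b)
  have hw : 0 ≤ ρ * ‖F (x, u) - w‖ ^ 2 := by positivity
  generalize ‖x - a‖ = X at *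
  generalize ‖u - b‖ = Y at *
  generalize ‖α‖ = A at *
  generalize ‖β‖ = B at *
  generalize ρ * ‖F (x, u) - w‖ ^ 2 = T at *
  have h3 : 0 ≤ σ * (X ^ 2 + Y ^ 2) := by positivity
  have h4 : X ^ 2 + Y ^ 2 + T ≤ A * X + B * Y := by nlinarith
  have hX : X ≤ A + B := by
    by_contra! hlt
    rcases le_total X Y with hXY | hXY <;> nlinarith
  have hY : Y ≤ A + B := by
    by_contra! hlt
    rcases le_total X Y with hXY | hXY <;> nlinarith
  exact ⟨hX, hY, by nlinarith [sq_nonneg (A - 2 * X), sq_nonneg (B - 2 * Y), mul_nonneg hα hβ]⟩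

/-- The base point has penalty zero, so only the sublevel set `penalty ≤ 0` matters. It is compact:
`x` and `u` are bounded, hence so is `F (x, u)`, and `w` stays close to it. -/
theorem exists_penalty_minimizer [ProperSpace X] [ProperSpace Y] [ProperSpace W]
    {F : X × Y → W} (hF : Continuous F) {U : Set Y}
    (hU : IsClosed U) {Θ : Set W} (hΘ : IsClosed Θ) {a : X} {b : Y} (hb : b ∈ U)
    (hab : F (a, b) ∈ Θ) (α : X) (β : Y) {σ ρ : ℝ} (hσ : 0 ≤ σ) (hρ : 0 < ρ) :
    ∃ x, ∃ u ∈ U, ∃ w ∈ Θ, penalty F a b α β σ ρ x u w ≤ 0 ∧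
      ∀ x', ∀ u' ∈ U, ∀ w' ∈ Θ, penalty F a b α β σ ρ x u w ≤ penalty F a b α β σ ρ x' u' w' := by
  set M := ‖α‖ + ‖β‖ with hM
  set P : X × Y × W → ℝ := fun p => penalty F a b α β σ ρ p.1 p.2.1 p.2.2 with hP
  have hPc : Continuous P := by
    simp only [hP]
    unfold penalty
    fun_prop
  have hP0 : P (a, b, F (a, b)) = 0 := by simp [hP, penalty]
  set A : Set (X × Y × W) := {p | p.2.1 ∈ U ∧ p.2.2 ∈ Θ ∧ P p ≤ 0} with hA
  have hAc : IsClosed A :=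
    (hU.preimage (by fun_prop)).inter ((hΘ.preimage (by fun_prop)).inter
      (isClosed_le hPc continuous_const))
  have hK : IsCompact (Metric.closedBall a M ×ˢ Metric.closedBall b M) :=
    (isCompact_closedBall a M).prod (isCompact_closedBall b M)
  obtain ⟨C, hC⟩ := (hK.image hF).isBounded.exists_norm_le
  have hsub : A ⊆ Metric.closedBall a M ×ˢ (Metric.closedBall b M ×ˢ
      Metric.closedBall (0 : W) (C + Real.sqrt (M ^ 2 / ρ))) := by
    rintro ⟨x, u, w⟩ ⟨-, -, hp⟩
    obtain ⟨h1, h2, h3⟩ := bounds_of_penalty_nonpos hσ hρ hp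
    have hx : x ∈ Metric.closedBall a M := by rwa [Metric.mem_closedBall, dist_eq_norm]
    have hu : u ∈ Metric.closedBall b M := by rwa [Metric.mem_closedBall, dist_eq_norm]
    refine ⟨hx, hu, ?_⟩
    have h4 := hC _ (mem_image_of_mem F (mk_mem_prod hx hu))
    have h5 := Real.le_sqrt_of_sq_le h3
    have e : w = F (x, u) - (F (x, u) - w) := by abel
    rw [mem_closedBall_zero_iff]
    change ‖w‖ ≤ _
    rw [e]
    exact (norm_sub_le _ _).trans (add_le_add h4 h5)
  have hAcomp : IsCompact A := ((isCompact_closedBall a M).prod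
    ((isCompact_closedBall b M).prod (isCompact_closedBall _ _))).of_isClosed_subset hAc hsub
  have ha : (a, b, F (a, b)) ∈ A := ⟨hb, hab, hP0.le⟩
  obtain ⟨⟨x, u, w⟩, ⟨h1, h2, h3⟩, h4⟩ := hAcomp.exists_isMinOn ⟨_, ha⟩ hPc.continuousOn
  refine ⟨x, u, h1, w, h2, h3, fun x' u' hu' w' hw' => ?_⟩
  by_cases hle : P (x', u', w') ≤ 0
  · exact h4 (show (x', u', w') ∈ A from ⟨hu', hw', hle⟩)
  · exact h3.trans (not_le.1 hle).le

/-- Points of nonpositive penalty approach the base point as the penalty parameter grows. -/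
theorem exists_penalty_parameter [ProperSpace X] [ProperSpace Y]
    {F : X × Y → W} (hF : Continuous F) {U : Set Y}
    (hU : IsClosed U) {Θ : Set W} (hΘ : IsClosed Θ) {a : X} {b : Y} {α : X} {β : Y} {σ : ℝ}
    (hσ : 0 ≤ σ)
    (hprox : ∀ x, ∀ u ∈ U, F (x, u) ∈ Θ →
      inner ℝ α (x - a) + inner ℝ β (u - b) ≤ σ * (‖x - a‖ ^ 2 + ‖u - b‖ ^ 2))
    {δ : ℝ} (hδ : 0 < δ) :
    ∃ ρ > 0, ∀ x, ∀ u ∈ U, ∀ w ∈ Θ, penalty F a b α β σ ρ x u w ≤ 0 →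
      ‖x - a‖ < δ ∧ ‖u - b‖ < δ ∧ ‖w - F (a, b)‖ < δ := by
  set M := ‖α‖ + ‖β‖ with hM
  by_contra! hcon
  have hpos : ∀ k : ℕ, (0 : ℝ) < (k : ℝ) + 1 := fun k => by positivity
  choose x u hu w hw hp hfar using fun k : ℕ => hcon ((k : ℝ) + 1) (hpos k)
  have hb := fun k => bounds_of_penalty_nonpos hσ (hpos k) (hp k)
  have hK : IsCompact (Metric.closedBall a M ×ˢ Metric.closedBall b M) :=
    (isCompact_closedBall a M).prod (isCompact_closedBall b M)
  obtain ⟨⟨y, v⟩, -, φ, hφ, hlim⟩ := hK.tendsto_subseq (x := fun k => (x k, u k)) (fun k =>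
    ⟨by rw [Metric.mem_closedBall, dist_eq_norm]; exact (hb k).1,
     by rw [Metric.mem_closedBall, dist_eq_norm]; exact (hb k).2.1⟩)
  have hx : Tendsto (fun k => x (φ k)) atTop (𝓝 y) := (continuous_fst.tendsto _).comp hlim
  have hv : Tendsto (fun k => u (φ k)) atTop (𝓝 v) := (continuous_snd.tendsto _).comp hlim
  have hFl : Tendsto (fun k => F (x (φ k), u (φ k))) atTop (𝓝 (F (y, v))) :=
    (hF.tendsto _).comp hlim
  have hd : Tendsto (fun k => ‖F (x k, u k) - w k‖ ^ 2) atTop (𝓝 0) := by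
    refine squeeze_zero (fun _ => by positivity) (fun k => (hb k).2.2) ?_
    have := (tendsto_one_div_add_atTop_nhds_zero_nat (𝕜 := ℝ)).const_mul (M ^ 2)
    simpa [div_eq_mul_inv] using this
  have hd2 : Tendsto (fun k => F (x k, u k) - w k) atTop (𝓝 0) := by
    rw [tendsto_zero_iff_norm_tendsto_zero]
    have := hd.sqrt
    simpa [Real.sqrt_sq] using this
  have hwl : Tendsto (fun k => w (φ k)) atTop (𝓝 (F (y, v))) := by
    have := hFl.sub (hd2.comp hφ.tendsto_atTop)
    simpa using this
  have hvU : v ∈ U := hU.mem_of_tendsto hv (Eventually.of_forall fun k => hu _)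
  have hyΘ : F (y, v) ∈ Θ := hΘ.mem_of_tendsto hwl (Eventually.of_forall fun k => hw _)
  have hle : (σ + 1) * (‖y - a‖ ^ 2 + ‖v - b‖ ^ 2) -
      (inner ℝ α (y - a) + inner ℝ β (v - b)) ≤ 0 := by
    have hc : Continuous fun p : X × Y => (σ + 1) * (‖p.1 - a‖ ^ 2 + ‖p.2 - b‖ ^ 2) -
      (inner ℝ α (p.1 - a) + inner ℝ β (p.2 - b)) := by fun_prop
    refine le_of_tendsto ((hc.tendsto (y, v)).comp hlim) (Eventually.of_forall fun k => ?_)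
    have h1 := hp (φ k)
    unfold penalty at h1
    have h2 : 0 ≤ ((φ k : ℝ) + 1) * ‖F (x (φ k), u (φ k)) - w (φ k)‖ ^ 2 := by positivity
    simp only [Function.comp]
    linarith
  have hpr := hprox y v hvU hyΘ
  -- The limit point is feasible, so the linear terms are at most `σ` times the squared distance,
  -- whereas `hle` bounds them below by `σ + 1` times it. The extra `1` in the penalty forces the
  -- distance to vanish.
  have hy2 : ‖y - a‖ = 0 := by nlinarith [sq_nonneg ‖y - a‖, sq_nonneg ‖v - b‖]
  have hv2 : ‖v - b‖ = 0 := by nlinarith [sq_nonneg ‖y - a‖, sq_nonneg ‖v - b‖]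
  have ey : y = a := by rwa [norm_eq_zero, sub_eq_zero] at hy2
  have ev : v = b := by rwa [norm_eq_zero, sub_eq_zero] at hv2
  subst ey ev
  have n1 : ∀ᶠ k in atTop, ‖x (φ k) - y‖ < δ := by
    have := (tendsto_iff_norm_sub_tendsto_zero.1 hx).eventually_lt_const hδ
    exact this
  have n2 : ∀ᶠ k in atTop, ‖u (φ k) - v‖ < δ :=
    (tendsto_iff_norm_sub_tendsto_zero.1 hv).eventually_lt_const hδ
  have n3 : ∀ᶠ k in atTop, ‖w (φ k) - F (y, v)‖ < δ :=
    (tendsto_iff_norm_sub_tendsto_zero.1 hwl).eventually_lt_const hδ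
  obtain ⟨k, h1, h2, h3⟩ := (n1.and (n2.and n3)).exists
  exact absurd h3 (not_lt.2 (hfar _ h1 h2))

end Penalty

theorem tendsto_clm_apply {E F ι : Type*} [NormedAddCommGroup E] [NormedSpace ℝ E]
    [NormedAddCommGroup F] [NormedSpace ℝ F] {f : Filter ι} {A : ι → E →L[ℝ] F} {v : ι → E}
    {A₀ : E →L[ℝ] F} {v₀ : E} (hA : Tendsto A f (𝓝 A₀)) (hv : Tendsto v f (𝓝 v₀)) :
    Tendsto (fun k => A k (v k)) f (𝓝 (A₀ v₀)) := by
  have h := (isBoundedBilinearMap_apply (𝕜 := ℝ) (E := E) (F := F)).continuous.tendsto (A₀, v₀)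
  exact h.comp (hA.prodMk_nhds hv)

/-! ### Approximate multipliers for proximal normals -/

section Multiplier

variable {X Y W : Type*} [NormedAddCommGroup X] [InnerProductSpace ℝ X] [ProperSpace X]
  [NormedAddCommGroup Y] [InnerProductSpace ℝ Y] [ProperSpace Y]
  [NormedAddCommGroup W] [InnerProductSpace ℝ W] [ProperSpace W]

/-- Transposed partial derivative in the first variable. -/
noncomputable def adjointFst (A : X × Y →L[ℝ] W) : W →L[ℝ] X :=
  ContinuousLinearMap.adjoint (A.comp (ContinuousLinearMap.inl ℝ X Y))

/-- Transposed partial derivative in the second variable. -/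
noncomputable def adjointSnd (A : X × Y →L[ℝ] W) : W →L[ℝ] Y :=
  ContinuousLinearMap.adjoint (A.comp (ContinuousLinearMap.inr ℝ X Y))

omit [ProperSpace Y] in
theorem continuous_adjointFst : Continuous (adjointFst : (X × Y →L[ℝ] W) → W →L[ℝ] X) :=
  (ContinuousLinearMap.adjoint : (X →L[ℝ] W) ≃ₗᵢ⋆[ℝ] (W →L[ℝ] X)).continuous.comp
    (continuous_id.clm_comp continuous_const)

omit [ProperSpace X] in
theorem continuous_adjointSnd : Continuous (adjointSnd : (X × Y →L[ℝ] W) → W →L[ℝ] Y) :=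
  (ContinuousLinearMap.adjoint : (Y →L[ℝ] W) ≃ₗᵢ⋆[ℝ] (W →L[ℝ] Y)).continuous.comp
    (continuous_id.clm_comp continuous_const)

omit [ProperSpace Y] in
theorem tendsto_adjointFst {ι : Type*} {f : Filter ι} {A : ι → X × Y →L[ℝ] W} {v : ι → W}
    {A₀ : X × Y →L[ℝ] W} {v₀ : W} (hA : Tendsto A f (𝓝 A₀)) (hv : Tendsto v f (𝓝 v₀)) :
    Tendsto (fun k => adjointFst (A k) (v k)) f (𝓝 (adjointFst A₀ v₀)) := by
  have h : Tendsto (fun k => adjointFst (A k)) f (𝓝 (adjointFst A₀)) :=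
    (continuous_adjointFst.tendsto A₀).comp hA
  exact tendsto_clm_apply h hv

omit [ProperSpace X] in
theorem tendsto_adjointSnd {ι : Type*} {f : Filter ι} {A : ι → X × Y →L[ℝ] W} {v : ι → W}
    {A₀ : X × Y →L[ℝ] W} {v₀ : W} (hA : Tendsto A f (𝓝 A₀)) (hv : Tendsto v f (𝓝 v₀)) :
    Tendsto (fun k => adjointSnd (A k) (v k)) f (𝓝 (adjointSnd A₀ v₀)) := by
  have h : Tendsto (fun k => adjointSnd (A k)) f (𝓝 (adjointSnd A₀)) :=
    (continuous_adjointSnd.tendsto A₀).comp hA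
  exact tendsto_clm_apply h hv

/-- Gradient of `x ↦ κ ‖x - a‖² - ⟨α, x - a⟩ + ρ ‖Φ x - w‖² + c`. -/
theorem hasGradientAt_quadratic_penalty {Φ : X → W} {Φ' : X →L[ℝ] W} {x : X}
    (hΦ : HasFDerivAt Φ Φ' x) (a α : X) (w : W) (κ ρ c : ℝ) :
    HasGradientAt (fun y => κ * ‖y - a‖ ^ 2 - inner ℝ α (y - a) + ρ * ‖Φ y - w‖ ^ 2 + c)
      ((2 * κ) • (x - a) - α + ContinuousLinearMap.adjoint Φ' ((2 * ρ) • (Φ x - w))) x := by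
  have h1 : HasFDerivAt (fun y => y - a) (ContinuousLinearMap.id ℝ X) x :=
    (hasFDerivAt_id x).sub_const a
  have h2 := (h1.norm_sq.const_mul κ).sub ((innerSL ℝ α).hasFDerivAt.comp x h1)
  have h3 := ((h2.add ((hΦ.sub_const w).norm_sq.const_mul ρ)).add_const c)
  rw [hasGradientAt_iff_hasFDerivAt]
  refine h3.congr_fderiv ?_
  ext d
  simp [ContinuousLinearMap.adjoint_inner_left]
  ring

/-- Read off optimality at a penalty minimizer in each variable. In `w`, it is a nearest point of
`Θ` to `F (x, u)`, so `2ρ (F (x, u) - w)` is a proximal normal; in `x`, the gradient vanishes; in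
`u`, minus the gradient is only a regular normal to `U`, which is exchanged for a proximal one at a
nearby `u'`. -/
theorem exists_approximate_multiplier {F : X × Y → W} (hF : Differentiable ℝ F) {U : Set Y}
    (hU : IsClosed U) {Θ : Set W} (hΘ : IsClosed Θ) {a : X} {b : Y} (hb : b ∈ U)
    (hab : F (a, b) ∈ Θ) {α : X} {β : Y} {σ : ℝ} (hσ : 0 ≤ σ)
    (hprox : ∀ x, ∀ u ∈ U, F (x, u) ∈ Θ →
      inner ℝ α (x - a) + inner ℝ β (u - b) ≤ σ * (‖x - a‖ ^ 2 + ‖u - b‖ ^ 2))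
    {δ : ℝ} (hδ : 0 < δ) :
    ∃ (z : X × Y) (w mult : W) (u' : Y) (β' : Y),
      ‖z.1 - a‖ < δ ∧ ‖z.2 - b‖ < δ ∧ ‖w - F (a, b)‖ < δ ∧ ‖u' - b‖ < δ ∧
      mult ∈ proximalNormalCone Θ w ∧ ‖adjointFst (fderiv ℝ F z) mult - α‖ < δ ∧
      ‖β' - β‖ < δ ∧ β' - adjointSnd (fderiv ℝ F z) mult ∈ proximalNormalCone U u' := by
  set κ : ℝ := σ + 1 with hκ
  have hκ1 : 1 ≤ κ := by linarith
  -- The error in `α` is below `2κη`, the one in `β` below `η + 2κη`, and `u'` is within `2η` of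
  -- `b`; as `κ ≥ 1`, all are less than `4κη = δ`.
  set η : ℝ := δ / (4 * κ) with hη
  have hη0 : 0 < η := by positivity
  have hηδ : 4 * κ * η = δ := by rw [hη]; field_simp
  have hηδ' : 2 * η < δ := by nlinarith
  obtain ⟨ρ, hρ, hnear⟩ := exists_penalty_parameter hF.continuous hU hΘ hσ hprox hη0
  obtain ⟨x, u, hu, w, hw, hP, hmin⟩ :=
    exists_penalty_minimizer hF.continuous hU hΘ hb hab α β hσ hρ
  obtain ⟨hx1, hu1, hw1⟩ := hnear x u hu w hw hP
  set mult : W := (2 * ρ) • (F (x, u) - w) with hmult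
  have hFx : HasFDerivAt (fun y => F (y, u))
      ((fderiv ℝ F (x, u)).comp (ContinuousLinearMap.inl ℝ X Y)) x :=
    (hF (x, u)).hasFDerivAt.comp x (hasFDerivAt_prodMk_left x u)
  have hFu : HasFDerivAt (fun y => F (x, y))
      ((fderiv ℝ F (x, u)).comp (ContinuousLinearMap.inr ℝ X Y)) u :=
    (hF (x, u)).hasFDerivAt.comp u (hasFDerivAt_prodMk_right x u)
  have hgx := hasGradientAt_quadratic_penalty hFx a α w κ ρ
    (κ * ‖u - b‖ ^ 2 - inner ℝ β (u - b))
  have hgu := hasGradientAt_quadratic_penalty hFu b β w κ ρ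
    (κ * ‖x - a‖ ^ 2 - inner ℝ α (x - a))
  have hx0 : (2 * κ) • (x - a) - α + adjointFst (fderiv ℝ F (x, u)) mult = 0 := by
    have hloc : IsLocalMin (fun y => κ * ‖y - a‖ ^ 2 - inner ℝ α (y - a) +
        ρ * ‖F (y, u) - w‖ ^ 2 + (κ * ‖u - b‖ ^ 2 - inner ℝ β (u - b))) x := by
      refine Eventually.of_forall fun y => ?_
      have := hmin y u hu w hw
      unfold penalty at this
      dsimp only
      linarith
    have h0 := hloc.hasFDerivAt_eq_zero hgx.hasFDerivAt
    exact (InnerProductSpace.toDual ℝ X).map_eq_zero_iff.1 h0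
  have hnorm : mult ∈ proximalNormalCone Θ w := by
    refine smul_sub_mem_proximalNormalCone hw (fun y hy => ?_) (by positivity)
    have := hmin x u hu y hy
    unfold penalty at this
    have h2 : ρ * ‖F (x, u) - w‖ ^ 2 ≤ ρ * ‖F (x, u) - y‖ ^ 2 := by linarith
    exact le_of_sq_le_sq (le_of_mul_le_mul_left h2 hρ) (norm_nonneg _)
  set β₁ : Y := β - (2 * κ) • (u - b) with hβ₁
  have hreg := eventually_inner_le_of_isMinOn (Ω := U) (x := u)
    (v := β₁ - adjointSnd (fderiv ℝ F (x, u)) mult)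
    (f := fun y => κ * ‖y - b‖ ^ 2 - inner ℝ β (y - b) +
        ρ * ‖F (x, y) - w‖ ^ 2 + (κ * ‖x - a‖ ^ 2 - inner ℝ α (x - a)))
    (fun y hy => by
      have := hmin x y hy w hw
      unfold penalty at this
      linarith)
    (by
      convert hgu using 1
      rw [hβ₁]
      unfold adjointSnd
      abel)
  obtain ⟨u', v', hv', hu', hvd⟩ := exists_proximalNormal_near hU hu hreg hη0
  refine ⟨(x, u), w, mult, u', v' + adjointSnd (fderiv ℝ F (x, u)) mult, by linarith,
    by linarith, by linarith, ?_, hnorm, ?_, ?_, by simpa using hv'⟩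
  · have e : u' - b = (u' - u) + (u - b) := by abel
    rw [e]
    refine (norm_add_le _ _).trans_lt ?_
    linarith
  · have e : adjointFst (fderiv ℝ F (x, u)) mult - α = -((2 * κ) • (x - a)) := by
      rw [eq_neg_iff_add_eq_zero, ← hx0]; abel
    rw [e, norm_neg, norm_smul, Real.norm_of_nonneg (by positivity)]
    nlinarith
  · have e : v' + adjointSnd (fderiv ℝ F (x, u)) mult - β =
        (v' - (β₁ - adjointSnd (fderiv ℝ F (x, u)) mult)) - (2 * κ) • (u - b) := by
      rw [hβ₁]; abel
    rw [e]
    refine (norm_sub_le _ _).trans_lt ?_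
    rw [norm_smul, Real.norm_of_nonneg (by positivity)]
    nlinarith

end Multiplier

/-! ### Compactness argument for the slope bound -/

section BoundedSlope

variable {X Y W : Type*} [NormedAddCommGroup X] [InnerProductSpace ℝ X] [ProperSpace X]
  [NormedAddCommGroup Y] [InnerProductSpace ℝ Y] [ProperSpace Y]
  [NormedAddCommGroup W] [InnerProductSpace ℝ W] [ProperSpace W]

theorem tendsto_of_norm_sub_le {E : Type*} [SeminormedAddCommGroup E] {a b : ℕ → E} {e : ℕ → ℝ}
    {y : E} (h : ∀ k, ‖a k - b k‖ ≤ e k) (he : Tendsto e atTop (𝓝 0)) (hb : Tendsto b atTop (𝓝 y)) :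
    Tendsto a atTop (𝓝 y) := by
  simpa using (squeeze_zero_norm h he).add hb

/-- Normals whose slope exceeds `k + 1`, normalized, give multipliers with errors of order
`1 / (k + 1)`. -/
theorem exists_normalized_multiplier {F : X × Y → W} (hFd : Differentiable ℝ F) {U : Set Y}
    (hU : IsClosed U) {Θ : Set W} (hΘ : IsClosed Θ) {K : Set (X × Y)} (k : ℕ)
    (hcon : ∃ a b, (a, b) ∈ K ∧ b ∈ U ∧ F (a, b) ∈ Θ ∧ ∃ (α : X) (β : Y) (σ : ℝ),
      0 ≤ σ ∧ (∀ x, ∀ u ∈ U, F (x, u) ∈ Θ →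
        inner ℝ α (x - a) + inner ℝ β (u - b) ≤ σ * (‖x - a‖ ^ 2 + ‖u - b‖ ^ 2)) ∧
      ((k : ℝ) + 1) * ‖β‖ < ‖α‖) :
    ∃ (p z : X × Y) (w mult : W) (u' : Y) (α : X) (β' : Y),
      p ∈ K ∧ ‖α‖ = 1 ∧ ‖z - p‖ ≤ 1 / ((k : ℝ) + 1) ∧ ‖w - F p‖ ≤ 1 / ((k : ℝ) + 1) ∧
      ‖u' - p.2‖ ≤ 1 / ((k : ℝ) + 1) ∧ mult ∈ proximalNormalCone Θ w ∧
      ‖adjointFst (fderiv ℝ F z) mult - α‖ ≤ 1 / ((k : ℝ) + 1) ∧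
      ‖β'‖ ≤ 1 / ((k : ℝ) + 1) + 1 / ((k : ℝ) + 1) ∧
      β' - adjointSnd (fderiv ℝ F z) mult ∈ proximalNormalCone U u' := by
  have hpos : (0 : ℝ) < (k : ℝ) + 1 := by positivity
  have hδ : (0 : ℝ) < 1 / ((k : ℝ) + 1) := by positivity
  obtain ⟨a, b, hab, hb, hΘab, α, β, σ, hσ, hpr, hlt⟩ := hcon
  have hα : 0 < ‖α‖ := lt_of_le_of_lt (by positivity) hlt
  -- Dividing by `‖α‖` makes the first component a unit vector and the second shorter than `1 / (k +
  -- 1)`.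
  obtain ⟨z, w, mult, u', β', h1, h2, h3, h4, h5, h6, h7, h8⟩ :=
    exists_approximate_multiplier hFd hU hΘ hb hΘab (α := ‖α‖⁻¹ • α) (β := ‖α‖⁻¹ • β)
      (σ := ‖α‖⁻¹ * σ) (by positivity) (fun x u hu hxu => by
        rw [real_inner_smul_left, real_inner_smul_left, ← mul_add, mul_assoc]
        exact mul_le_mul_of_nonneg_left (hpr x u hu hxu) (by positivity)) hδ
  refine ⟨(a, b), z, w, mult, u', ‖α‖⁻¹ • α, β', hab, ?_, ?_, h3.le, h4.le, h5, h6.le, ?_, h8⟩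
  · rw [norm_smul, norm_inv, norm_norm, inv_mul_cancel₀ hα.ne']
  · exact max_le h1.le h2.le
  · have e : β' = (β' - ‖α‖⁻¹ • β) + ‖α‖⁻¹ • β := by abel
    rw [e]
    refine (norm_add_le _ _).trans (add_le_add h7.le ?_)
    rw [norm_smul, norm_inv, norm_norm, inv_mul_le_iff₀ hα, mul_one_div,
      le_div_iff₀ hpos, mul_comm]
    exact hlt.le

/-- If the constraint system `u ∈ U`, `F (x, u) ∈ Θ` satisfies the limiting qualification condition
with respect to `u` on a compact set `K`, then its proximal normals at points of `K` have uniformly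
bounded slope. -/
theorem exists_slope_bound {F : X × Y → W}
    (hF : ∀ z, ∃ F' : X × Y →L[ℝ] W, HasStrictFDerivAt F F' z) {U : Set Y}
    (hU : IsClosed U) {Θ : Set W} (hΘ : IsClosed Θ) {K : Set (X × Y)} (hK : IsCompact K)
    (hqual : ∀ z ∈ K, ∀ mult ∈ limitingNormalCone Θ (F z),
      -adjointSnd (fderiv ℝ F z) mult ∈ limitingNormalCone U z.2 → mult = 0) :
    ∃ C : ℝ, 0 < C ∧ ∀ a b, (a, b) ∈ K → b ∈ U → F (a, b) ∈ Θ → ∀ (α : X) (β : Y) (σ : ℝ),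
      0 ≤ σ → (∀ x, ∀ u ∈ U, F (x, u) ∈ Θ →
        inner ℝ α (x - a) + inner ℝ β (u - b) ≤ σ * (‖x - a‖ ^ 2 + ‖u - b‖ ^ 2)) →
      ‖α‖ ≤ C * ‖β‖ := by
  have hFd : Differentiable ℝ F := fun z =>
    let ⟨_, h⟩ := hF z; h.hasFDerivAt.differentiableAt
  have hF' : Continuous (fderiv ℝ F) := continuous_iff_continuousAt.2 fun z =>
    let ⟨_, h⟩ := hF z; continuousAt_fderiv_of_hasStrictFDerivAt h hFd
  by_contra! hcon
  have hpos : ∀ k : ℕ, (0 : ℝ) < (k : ℝ) + 1 := fun k => by positivity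
  have step := fun k : ℕ => exists_normalized_multiplier hFd hU hΘ k (hcon _ (hpos k))
  choose p z w mult u' α β' hp hα hz hw hu' hm h1 hβ h2 using step
  -- The multipliers need not be bounded. With this scaling `s + ‖s • mult‖ = 1`, so `s` and the
  -- scaled multiplier cannot both tend to zero; bounded and unbounded sequences are handled
  -- together.
  set s : ℕ → ℝ := fun k => (1 + ‖mult k‖)⁻¹ with hs
  have hs0 : ∀ k, 0 ≤ s k := fun k => by positivity
  have hs1 : ∀ k, s k ≤ 1 := fun k => inv_le_one_of_one_le₀ (by linarith [norm_nonneg (mult k)])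
  have hsm : ∀ k, s k + ‖s k • mult k‖ = 1 := fun k => by
    rw [norm_smul, Real.norm_of_nonneg (hs0 k)]
    have : 1 + ‖mult k‖ ≠ 0 := by positivity
    simp only [hs]
    field_simp
  have hcomp : IsCompact (K ×ˢ (Metric.sphere (0 : X) 1 ×ˢ
      (Icc (0 : ℝ) 1 ×ˢ Metric.closedBall (0 : W) 1))) :=
    hK.prod ((isCompact_sphere 0 1).prod (isCompact_Icc.prod (isCompact_closedBall 0 1)))
  obtain ⟨⟨q, A, t, Λ⟩, ⟨hq, hA, -, -⟩, φ, hφ, hlim⟩ := hcomp.tendsto_subseq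
    (x := fun k => (p k, α k, s k, s k • mult k)) (fun k => ⟨hp k, by simp [hα],
      ⟨hs0 k, hs1 k⟩, by rw [mem_closedBall_zero_iff]; linarith [hsm k, hs0 k]⟩)
  have lp : Tendsto (fun k => p (φ k)) atTop (𝓝 q) := (continuous_fst.tendsto _).comp hlim
  have lα : Tendsto (fun k => α (φ k)) atTop (𝓝 A) :=
    ((continuous_fst.comp continuous_snd).tendsto _).comp hlim
  have ls : Tendsto (fun k => s (φ k)) atTop (𝓝 t) :=
    ((continuous_fst.comp (continuous_snd.comp continuous_snd)).tendsto _).comp hlim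
  have lm : Tendsto (fun k => s (φ k) • mult (φ k)) atTop (𝓝 Λ) :=
    ((continuous_snd.comp (continuous_snd.comp continuous_snd)).tendsto _).comp hlim
  have lε : Tendsto (fun k => 1 / ((φ k : ℝ) + 1)) atTop (𝓝 0) :=
    (tendsto_one_div_add_atTop_nhds_zero_nat (𝕜 := ℝ)).comp hφ.tendsto_atTop
  have lz : Tendsto (fun k => z (φ k)) atTop (𝓝 q) :=
    tendsto_of_norm_sub_le (fun k => hz (φ k)) lε lp
  have lw : Tendsto (fun k => w (φ k)) atTop (𝓝 (F q)) :=
    tendsto_of_norm_sub_le (fun k => hw (φ k)) lε ((hFd.continuous.tendsto q).comp lp)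
  have lu : Tendsto (fun k => u' (φ k)) atTop (𝓝 q.2) :=
    tendsto_of_norm_sub_le (fun k => hu' (φ k)) lε ((continuous_snd.tendsto q).comp lp)
  have lβ : Tendsto (fun k => β' (φ k)) atTop (𝓝 0) :=
    squeeze_zero_norm (fun k => hβ (φ k)) (by simpa using lε.add lε)
  have lF : Tendsto (fun k => fderiv ℝ F (z (φ k))) atTop (𝓝 (fderiv ℝ F q)) :=
    (hF'.tendsto q).comp lz
  have lX : Tendsto (fun k => adjointFst (fderiv ℝ F (z (φ k))) (s (φ k) • mult (φ k))) atTop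
      (𝓝 (adjointFst (fderiv ℝ F q) Λ)) :=
    tendsto_adjointFst lF lm
  have lX' : Tendsto (fun k => adjointFst (fderiv ℝ F (z (φ k))) (s (φ k) • mult (φ k))) atTop
      (𝓝 (t • A)) := by
    refine tendsto_of_norm_sub_le (fun k => ?_) lε (ls.smul lα)
    rw [map_smul, ← smul_sub, norm_smul, Real.norm_of_nonneg (hs0 _)]
    exact (mul_le_of_le_one_left (norm_nonneg _) (hs1 _)).trans (h1 _)
  have lY : Tendsto (fun k => s (φ k) •
      (β' (φ k) - adjointSnd (fderiv ℝ F (z (φ k))) (mult (φ k)))) atTop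
      (𝓝 (-adjointSnd (fderiv ℝ F q) Λ)) := by
    have := (ls.smul lβ).sub (tendsto_adjointSnd lF lm)
    simpa [smul_sub] using this
  -- Both proximal normal cones are invariant under scaling by `s ≥ 0`, and the `β'` contribution
  -- vanishes in the limit, so the qualification applies to `Λ`. Then `t = 1`, and the limit of the
  -- `x`-equation gives `A = 0` although `‖A‖ = 1`.
  have hΛ : Λ = 0 := hqual q hq Λ
    ⟨_, _, lw, lm, fun k => smul_mem_proximalNormalCone (hs0 _) (hm _)⟩
    ⟨_, _, lu, lY, fun k => smul_mem_proximalNormalCone (hs0 _) (h2 _)⟩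
  have ht : t = 1 := by
    have h3 := ls.add lm.norm
    simp only [hsm] at h3
    simpa [hΛ] using (tendsto_nhds_unique h3 tendsto_const_nhds)
  have hA0 : A = 0 := by
    have := tendsto_nhds_unique lX' lX
    simpa [ht, hΛ] using this
  simp [hA0] at hA

end BoundedSlope

/-! ### Normals to the set of admissible constraint values -/

section Complementarity

variable {l₁ l₂ l : ℕ}

/-- Index set of all constraint values `(g, h, G, H)`. -/
abbrev ConstraintIndex (l₁ l₂ l : ℕ) : Type := (Fin l₁ ⊕ Fin l₂) ⊕ (Fin l ⊕ Fin l)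

/-- The admissible constraint values: `g ≤ 0`, `h = 0`, `0 ≤ G ⊥ H ≥ 0`. -/
def admissibleValues (l₁ l₂ l : ℕ) : Set (EuclideanSpace ℝ (ConstraintIndex l₁ l₂ l)) :=
  {w | (∀ i, w (.inl (.inl i)) ≤ 0) ∧ (∀ i, w (.inl (.inr i)) = 0) ∧
    (∀ i, 0 ≤ w (.inr (.inl i))) ∧ (∀ i, 0 ≤ w (.inr (.inr i))) ∧
    ∀ i, w (.inr (.inl i)) * w (.inr (.inr i)) = 0}

theorem isClosed_admissibleValues : IsClosed (admissibleValues l₁ l₂ l) := by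
  have hc : ∀ j : ConstraintIndex l₁ l₂ l,
      Continuous fun w : EuclideanSpace ℝ (ConstraintIndex l₁ l₂ l) => w j := fun j => by fun_prop
  simp only [admissibleValues, ofPred_and, ofPred_forall]
  refine IsClosed.inter (isClosed_iInter fun i => isClosed_le (hc _) continuous_const)
    (IsClosed.inter (isClosed_iInter fun i => isClosed_eq (hc _) continuous_const)
    (IsClosed.inter (isClosed_iInter fun i => isClosed_le continuous_const (hc _))
    (IsClosed.inter (isClosed_iInter fun i => isClosed_le continuous_const (hc _))
    (isClosed_iInter fun i => isClosed_eq ((hc _).mul (hc _)) continuous_const))))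

theorem mem_complementarityCone_iff {a b : Euc l} :
    (a, b) ∈ complementarityCone l ↔ (∀ i, 0 ≤ a i) ∧ (∀ i, 0 ≤ b i) ∧ ∀ i, a i * b i = 0 := by
  unfold complementarityCone
  simp only [mem_ofPred_eq]
  refine and_congr_right fun ha => and_congr_right fun hb => ?_
  rw [PiLp.inner_apply, Finset.sum_eq_zero_iff_of_nonneg
    (fun i _ => by simpa using mul_nonneg (hb i) (ha i))]
  simp [mul_comm]

/-- A proximal normal is nonpositive along every coordinate direction that is feasible. -/
theorem mul_nonpos_of_mem_proximalNormalCone {ι : Type*} [Fintype ι] [DecidableEq ι]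
    {Θ : Set (EuclideanSpace ℝ ι)} {w v : EuclideanSpace ℝ ι} (hv : v ∈ proximalNormalCone Θ w)
    (j : ι) (c : ℝ) {r : ℝ} (hr : 0 < r)
    (h : ∀ t, 0 < t → t < r → w + EuclideanSpace.single j (t * c) ∈ Θ) : v j * c ≤ 0 := by
  obtain ⟨-, σ, -, hσ⟩ := hv
  -- The proximal inequality at a step of length `t` has a right-hand side of order `t²`; division
  -- by `t` leaves a bound that vanishes as `t → 0`.
  have key : ∀ t, 0 < t → t < r → v j * c ≤ t * (σ * c ^ 2) := by
    intro t ht htr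
    have h1 := hσ _ (h t ht htr)
    rw [add_sub_cancel_left, EuclideanSpace.inner_single_right, PiLp.norm_single,
      Real.norm_eq_abs, sq_abs] at h1
    simp only [conj_trivial] at h1
    have h2 : t * (v j * c) ≤ t * (t * (σ * c ^ 2)) := by linarith
    exact le_of_mul_le_mul_left h2 ht
  have hlim : Tendsto (fun t : ℝ => t * (σ * c ^ 2)) (𝓝[>] 0) (𝓝 0) := by
    have : Tendsto (fun t : ℝ => t * (σ * c ^ 2)) (𝓝 0) (𝓝 (0 * (σ * c ^ 2))) :=
      tendsto_id.mul_const _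
    rw [zero_mul] at this
    exact this.mono_left nhdsWithin_le_nhds
  refine ge_of_tendsto hlim ?_
  filter_upwards [Ioo_mem_nhdsGT hr] with t ht using key t ht.1 ht.2

theorem mem_of_mem_proximalNormalCone {V : Type*} [NormedAddCommGroup V] [InnerProductSpace ℝ V]
    {Ω : Set V} (hΩ : IsClosed Ω) {x v : V} (hv : v ∈ proximalNormalCone Ω x) : x ∈ Ω :=
  hΩ.closure_eq ▸ hv.1

variable {w v : EuclideanSpace ℝ (ConstraintIndex l₁ l₂ l)}

/-- Lowering a value of `g` preserves admissibility. The companion lemmas likewise test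
single-coordinate moves: a slack inequality may also be raised a little. -/
theorem proximal_inequality_nonneg (hv : v ∈ proximalNormalCone (admissibleValues l₁ l₂ l) w)
    (i : Fin l₁) : 0 ≤ v (.inl (.inl i)) := by
  obtain ⟨h1, h2, h3, h4, h5⟩ := mem_of_mem_proximalNormalCone isClosed_admissibleValues hv
  have := mul_nonpos_of_mem_proximalNormalCone hv (.inl (.inl i)) (-1) one_pos
    (fun t ht _ => by
      refine ⟨fun k => ?_, fun k => ?_, fun k => ?_, fun k => ?_, fun k => ?_⟩
      · have := h1 k
        by_cases hk : k = i <;> simp [hk] at this ⊢ <;> linarith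
      all_goals simp_all)
  linarith

theorem proximal_inequality_eq_zero (hv : v ∈ proximalNormalCone (admissibleValues l₁ l₂ l) w)
    {i : Fin l₁} (hi : w (.inl (.inl i)) < 0) : v (.inl (.inl i)) = 0 := by
  obtain ⟨h1, h2, h3, h4, h5⟩ := mem_of_mem_proximalNormalCone isClosed_admissibleValues hv
  refine le_antisymm ?_ (proximal_inequality_nonneg hv i)
  have := mul_nonpos_of_mem_proximalNormalCone hv (.inl (.inl i)) 1 (neg_pos.2 hi)
    (fun t ht htr => by
      refine ⟨fun k => ?_, fun k => ?_, fun k => ?_, fun k => ?_, fun k => ?_⟩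
      · have := h1 k
        by_cases hk : k = i <;> simp [hk] at this ⊢ <;> linarith
      all_goals simp_all)
  linarith

/-- When `H i = 0`, raising `G i` keeps the product zero. If moreover `G i > 0`, it can also be
lowered by less than its value, which makes the normal component vanish. -/
theorem proximal_left_nonpos (hv : v ∈ proximalNormalCone (admissibleValues l₁ l₂ l) w)
    {i : Fin l} (hi : w (.inr (.inr i)) = 0) : v (.inr (.inl i)) ≤ 0 := by
  obtain ⟨h1, h2, h3, h4, h5⟩ := mem_of_mem_proximalNormalCone isClosed_admissibleValues hv
  have := mul_nonpos_of_mem_proximalNormalCone hv (.inr (.inl i)) 1 one_pos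
    (fun t ht _ => by
      refine ⟨fun k => ?_, fun k => ?_, fun k => ?_, fun k => ?_, fun k => ?_⟩
      · simp_all
      · simp_all
      · have := h3 k
        by_cases hk : k = i <;> simp [hk] at this ⊢ <;> linarith
      · simp_all
      · have := h5 k
        by_cases hk : k = i
        · subst hk; simp [hi]
        · simpa [hk] using this)
  linarith

theorem proximal_left_eq_zero (hv : v ∈ proximalNormalCone (admissibleValues l₁ l₂ l) w)
    {i : Fin l} (hi : 0 < w (.inr (.inl i))) : v (.inr (.inl i)) = 0 := by
  obtain ⟨h1, h2, h3, h4, h5⟩ := mem_of_mem_proximalNormalCone isClosed_admissibleValues hv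
  have h0 : w (.inr (.inr i)) = 0 := (mul_eq_zero.1 (h5 i)).resolve_left hi.ne'
  refine le_antisymm (proximal_left_nonpos hv h0) ?_
  have := mul_nonpos_of_mem_proximalNormalCone hv (.inr (.inl i)) (-1) hi
    (fun t ht htr => by
      refine ⟨fun k => ?_, fun k => ?_, fun k => ?_, fun k => ?_, fun k => ?_⟩
      · simp_all
      · simp_all
      · have := h3 k
        by_cases hk : k = i <;> simp [hk] at this ⊢ <;> linarith
      · simp_all
      · have := h5 k
        by_cases hk : k = i
        · subst hk; simp [h0]
        · simpa [hk] using this)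
  linarith

theorem proximal_right_nonpos (hv : v ∈ proximalNormalCone (admissibleValues l₁ l₂ l) w)
    {i : Fin l} (hi : w (.inr (.inl i)) = 0) : v (.inr (.inr i)) ≤ 0 := by
  obtain ⟨h1, h2, h3, h4, h5⟩ := mem_of_mem_proximalNormalCone isClosed_admissibleValues hv
  have := mul_nonpos_of_mem_proximalNormalCone hv (.inr (.inr i)) 1 one_pos
    (fun t ht _ => by
      refine ⟨fun k => ?_, fun k => ?_, fun k => ?_, fun k => ?_, fun k => ?_⟩
      · simp_all
      · simp_all
      · simp_all
      · have := h4 k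
        by_cases hk : k = i <;> simp [hk] at this ⊢ <;> linarith
      · have := h5 k
        by_cases hk : k = i
        · subst hk; simp [hi]
        · simpa [hk] using this)
  linarith

theorem proximal_right_eq_zero (hv : v ∈ proximalNormalCone (admissibleValues l₁ l₂ l) w)
    {i : Fin l} (hi : 0 < w (.inr (.inr i))) : v (.inr (.inr i)) = 0 := by
  obtain ⟨h1, h2, h3, h4, h5⟩ := mem_of_mem_proximalNormalCone isClosed_admissibleValues hv
  have h0 : w (.inr (.inl i)) = 0 := (mul_eq_zero.1 (h5 i)).resolve_right hi.ne'
  refine le_antisymm (proximal_right_nonpos hv h0) ?_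
  have := mul_nonpos_of_mem_proximalNormalCone hv (.inr (.inr i)) (-1) hi
    (fun t ht htr => by
      refine ⟨fun k => ?_, fun k => ?_, fun k => ?_, fun k => ?_, fun k => ?_⟩
      · simp_all
      · simp_all
      · simp_all
      · have := h4 k
        by_cases hk : k = i <;> simp [hk] at this ⊢ <;> linarith
      · have := h5 k
        by_cases hk : k = i
        · subst hk; simp [h0]
        · simpa [hk] using this)
  linarith

/-- The alternative is stated with weak inequalities and for every index, active or not, so that it
defines a closed condition and survives passage to limiting normals. -/
theorem proximal_biactive (hv : v ∈ proximalNormalCone (admissibleValues l₁ l₂ l) w)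
    (i : Fin l) : (v (.inr (.inl i)) ≤ 0 ∧ v (.inr (.inr i)) ≤ 0) ∨
      v (.inr (.inl i)) * v (.inr (.inr i)) = 0 := by
  obtain ⟨h1, h2, h3, h4, h5⟩ := mem_of_mem_proximalNormalCone isClosed_admissibleValues hv
  rcases (h3 i).eq_or_lt with hG | hG
  · rcases (h4 i).eq_or_lt with hH | hH
    · exact Or.inl ⟨proximal_left_nonpos hv hH.symm, proximal_right_nonpos hv hG.symm⟩
    · exact Or.inr (by rw [proximal_right_eq_zero hv hH, mul_zero])
  · exact Or.inr (by rw [proximal_left_eq_zero hv hG, zero_mul])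

/-- Sign conditions satisfied by limiting normals to the set of admissible constraint values. -/
theorem limiting_signs (hv : v ∈ limitingNormalCone (admissibleValues l₁ l₂ l) w) :
    (∀ i, 0 ≤ v (.inl (.inl i))) ∧ (∀ i, w (.inl (.inl i)) < 0 → v (.inl (.inl i)) = 0) ∧
    (∀ i, 0 < w (.inr (.inl i)) → v (.inr (.inl i)) = 0) ∧
    (∀ i, 0 < w (.inr (.inr i)) → v (.inr (.inr i)) = 0) ∧
    (∀ i, (v (.inr (.inl i)) < 0 ∧ v (.inr (.inr i)) < 0) ∨
      v (.inr (.inl i)) * v (.inr (.inr i)) = 0) := by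
  obtain ⟨ws, vs, hw, hvs, hn⟩ := hv
  have cw : ∀ j, Tendsto (fun k => ws k j) atTop (𝓝 (w j)) := fun j =>
    ((by fun_prop : Continuous fun y : EuclideanSpace ℝ (ConstraintIndex l₁ l₂ l) => y j).tendsto
      w).comp hw
  have cv : ∀ j, Tendsto (fun k => vs k j) atTop (𝓝 (v j)) := fun j =>
    ((by fun_prop : Continuous fun y : EuclideanSpace ℝ (ConstraintIndex l₁ l₂ l) => y j).tendsto
      v).comp hvs
  have lim0 : ∀ j, (∀ᶠ k in atTop, vs k j = 0) → v j = 0 := fun j hj =>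
    tendsto_nhds_unique (cv j) (tendsto_const_nhds.congr' (hj.mono fun k hk => hk.symm))
  refine ⟨fun i => ge_of_tendsto' (cv _) fun k => proximal_inequality_nonneg (hn k) i,
    fun i hi => lim0 _ (((cw _).eventually_lt_const hi).mono fun k hk =>
      proximal_inequality_eq_zero (hn k) hk),
    fun i hi => lim0 _ (((cw _).eventually_const_lt hi).mono fun k hk =>
      proximal_left_eq_zero (hn k) hk),
    fun i hi => lim0 _ (((cw _).eventually_const_lt hi).mono fun k hk =>
      proximal_right_eq_zero (hn k) hk), fun i => ?_⟩
  have hcl : IsClosed {p : ℝ × ℝ | (p.1 ≤ 0 ∧ p.2 ≤ 0) ∨ p.1 * p.2 = 0} :=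
    ((isClosed_le continuous_fst continuous_const).inter
      (isClosed_le continuous_snd continuous_const)).union
      (isClosed_eq (continuous_fst.mul continuous_snd) continuous_const)
  have hmem : (v (.inr (.inl i)), v (.inr (.inr i))) ∈
      {p : ℝ × ℝ | (p.1 ≤ 0 ∧ p.2 ≤ 0) ∨ p.1 * p.2 = 0} :=
    hcl.mem_of_tendsto ((cv _).prodMk_nhds (cv _))
      (Eventually.of_forall fun k => proximal_biactive (hn k) i)
  -- The strict signs are recovered because a zero component falls under the vanishing product.
  rcases hmem with ⟨ha, hb⟩ | h0
  · rcases ha.eq_or_lt with ha | ha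
    · exact Or.inr (mul_eq_zero_of_left ha _)
    · rcases hb.eq_or_lt with hb | hb
      · exact Or.inr (mul_eq_zero_of_right _ hb)
      · exact Or.inl ⟨ha, hb⟩
  · exact Or.inr h0

end Complementarity

/-! ### From the Mangasarian-Fromovitz condition to the abstract qualification -/

section ConstraintMap

variable {n m l₁ l₂ l : ℕ} {g : Euc n × Euc m → Euc l₁} {h : Euc n × Euc m → Euc l₂}
  {G H : Euc n × Euc m → Euc l}

/-- All constraint functions collected into one map. -/
noncomputable def constraintMap (g : Euc n × Euc m → Euc l₁) (h : Euc n × Euc m → Euc l₂)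
    (G H : Euc n × Euc m → Euc l) (z : Euc n × Euc m) :
    EuclideanSpace ℝ (ConstraintIndex l₁ l₂ l) :=
  WithLp.toLp 2 (Sum.elim (Sum.elim (g z) (h z)) (Sum.elim (G z) (H z)))

theorem constraintMap_hasStrictFDerivAt (hg : StrictlyDifferentiable g)
    (hh : StrictlyDifferentiable h) (hG : StrictlyDifferentiable G)
    (hH : StrictlyDifferentiable H) (z : Euc n × Euc m) :
    ∃ F' : Euc n × Euc m →L[ℝ] EuclideanSpace ℝ (ConstraintIndex l₁ l₂ l),
      HasStrictFDerivAt (constraintMap g h G H) F' z := by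
  have hcomp : ∀ j : ConstraintIndex l₁ l₂ l, ∃ f' : Euc n × Euc m →L[ℝ] ℝ,
      HasStrictFDerivAt (fun y => constraintMap g h G H y j) f' z := by
    rintro ((i | i) | (i | i))
    · obtain ⟨f', hf⟩ := hg z; exact ⟨_, hasStrictFDerivAt_euclidean.1 hf i⟩
    · obtain ⟨f', hf⟩ := hh z; exact ⟨_, hasStrictFDerivAt_euclidean.1 hf i⟩
    · obtain ⟨f', hf⟩ := hG z; exact ⟨_, hasStrictFDerivAt_euclidean.1 hf i⟩
    · obtain ⟨f', hf⟩ := hH z; exact ⟨_, hasStrictFDerivAt_euclidean.1 hf i⟩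
  choose f' hf' using hcomp
  refine ⟨(EuclideanSpace.equiv (ConstraintIndex l₁ l₂ l) ℝ).symm.toContinuousLinearMap.comp
    (ContinuousLinearMap.pi f'), hasStrictFDerivAt_euclidean.2 fun j => ?_⟩
  exact hf' j

theorem mem_constraintSet_iff {U : Set (Euc m)} {z : Euc n × Euc m} :
    z ∈ constraintSet U g h G H ↔
      z.2 ∈ U ∧ constraintMap g h G H z ∈ admissibleValues l₁ l₂ l := by
  simp only [constraintSet, mem_ofPred_eq, mem_complementarityCone_iff, admissibleValues,
    constraintMap, Sum.elim_inl, Sum.elim_inr]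
  refine and_congr_right fun _ => and_congr_right fun _ => and_congr_left fun _ => ?_
  exact ⟨fun h0 i => by simp [h0], fun h0 => by ext i; simpa using h0 i⟩

/-- The complementarity components change sign because `Ψ` subtracts the terms in `G` and `H`;
nonpositive normal components thus become nonnegative `μ`, `ν`. -/
theorem Psi_eq_inner (v : EuclideanSpace ℝ (ConstraintIndex l₁ l₂ l)) (x : Euc n) (u : Euc m) :
    Psi g h G H (WithLp.toLp 2 fun i => v (.inl (.inl i))) (WithLp.toLp 2 fun i => v (.inl (.inr i)))
      (WithLp.toLp 2 fun i => -v (.inr (.inl i))) (WithLp.toLp 2 fun i => -v (.inr (.inr i))) x u =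
    inner ℝ v (constraintMap g h G H (x, u)) := by
  simp [Psi, constraintMap, PiLp.inner_apply, Fintype.sum_sum_type, mul_comm]
  ring

/-- A limiting normal to the admissible values, with this sign change, is a multiplier of M-type,
and `∇_u Ψ` is `adjointSnd` of the derivative applied to it. Hence `hU` is the stationarity
inclusion and `MFCondition` applies. -/
theorem MFCondition.eq_zero_of_limiting {U : Set (Euc m)} {x : Euc n} {u : Euc m}
    (hMF : MFCondition U g h G H x u) (hd : DifferentiableAt ℝ (constraintMap g h G H) (x, u))
    {v : EuclideanSpace ℝ (ConstraintIndex l₁ l₂ l)}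
    (hv : v ∈ limitingNormalCone (admissibleValues l₁ l₂ l) (constraintMap g h G H (x, u)))
    (hU : -adjointSnd (fderiv ℝ (constraintMap g h G H) (x, u)) v ∈ limitingNormalCone U u) :
    v = 0 := by
  obtain ⟨h1, h2, h3, h4, h5⟩ := limiting_signs hv
  have hgrad : gradient (Psi g h G H (WithLp.toLp 2 fun i => v (.inl (.inl i)))
      (WithLp.toLp 2 fun i => v (.inl (.inr i))) (WithLp.toLp 2 fun i => -v (.inr (.inl i)))
      (WithLp.toLp 2 fun i => -v (.inr (.inr i))) x) u =
      adjointSnd (fderiv ℝ (constraintMap g h G H) (x, u)) v := by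
    refine HasGradientAt.gradient ?_
    rw [hasGradientAt_iff_hasFDerivAt, funext (Psi_eq_inner v x)]
    have hF : HasFDerivAt (fun y => constraintMap g h G H (x, y))
      ((fderiv ℝ (constraintMap g h G H) (x, u)).comp
        (ContinuousLinearMap.inr ℝ (Euc n) (Euc m))) u :=
      hd.hasFDerivAt.comp u (hasFDerivAt_prodMk_right x u)
    refine ((innerSL ℝ v).hasFDerivAt.comp u hF).congr_fderiv ?_
    refine ContinuousLinearMap.ext fun d => ?_
    simp [adjointSnd, ContinuousLinearMap.adjoint_inner_left]
  obtain ⟨e1, e2, e3, e4⟩ := hMF (WithLp.toLp 2 fun i => v (.inl (.inl i)))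
    (WithLp.toLp 2 fun i => v (.inl (.inr i))) (WithLp.toLp 2 fun i => -v (.inr (.inl i)))
    (WithLp.toLp 2 fun i => -v (.inr (.inr i))) ⟨_, hU, by rw [hgrad]; abel⟩ h1 h2
    (fun i hi _ => by simpa using h3 i hi) (fun i _ hi => by simpa using h4 i hi)
    (fun i _ _ => by simpa using h5 i)
  ext j
  rcases j with (i | i) | (i | i)
  · exact congrArg (fun y : Euc l₁ => y i) e1
  · exact congrArg (fun y : Euc l₂ => y i) e2
  · exact neg_eq_zero.1 (congrArg (fun y : Euc l => y i) e3)
  · exact neg_eq_zero.1 (congrArg (fun y : Euc l => y i) e4)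

end ConstraintMap

end OCPEC

theorem mainTheorem10 {n m l₁ l₂ l : ℕ} (t₀ t₁ : ℝ)
    (U : Set (OCPEC.Euc m)) (hU : IsClosed U)
    (g : OCPEC.Euc n × OCPEC.Euc m → OCPEC.Euc l₁)
    (h : OCPEC.Euc n × OCPEC.Euc m → OCPEC.Euc l₂)
    (G H : OCPEC.Euc n × OCPEC.Euc m → OCPEC.Euc l)
    (hg : OCPEC.StrictlyDifferentiable g) (hh : OCPEC.StrictlyDifferentiable h)
    (hG : OCPEC.StrictlyDifferentiable G) (hH : OCPEC.StrictlyDifferentiable H)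
    (xstar : ℝ → OCPEC.Euc n) (ustar : ℝ → OCPEC.Euc m) (R : ℝ → ℝ≥0∞)
    (ε : ℝ) (hε : 0 < ε)
    (hC : IsCompact (OCPEC.localTube t₀ t₁ (fun _ => OCPEC.constraintSet U g h G H)
      xstar ustar ε R))
    (hMF : ∀ (t : ℝ) (x : OCPEC.Euc n) (u : OCPEC.Euc m),
      (t, x, u) ∈ OCPEC.localTube t₀ t₁ (fun _ => OCPEC.constraintSet U g h G H)
        xstar ustar ε R →
      OCPEC.MFCondition U g h G H x u) :
    ∃ π : ℝ, 0 < π ∧ ∀ t ∈ Icc t₀ t₁,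
      OCPEC.BoundedSlope (fun _ => OCPEC.constraintSet U g h G H) xstar ustar ε R
        (fun _ => π) t := by
  have hF := OCPEC.constraintMap_hasStrictFDerivAt hg hh hG hH
  -- The compact set is the projection of the tube to `(x, u)`; forgetting `t` makes the constant
  -- independent of time.
  obtain ⟨C, hC0, hslope⟩ := OCPEC.exists_slope_bound hF hU OCPEC.isClosed_admissibleValues
    (hC.image continuous_snd) (by
      rintro _ ⟨⟨t, x, u⟩, hz, rfl⟩ v hv hvU
      obtain ⟨F', hF'⟩ := hF (x, u)
      exact (hMF t x u hz).eq_zero_of_limiting hF'.hasFDerivAt.differentiableAt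
        hv hvU)
  refine ⟨C, hC0, fun t ht x u hxu α β hn => ?_⟩
  obtain ⟨-, σ, hσ, hprox⟩ := hn
  obtain ⟨hxU, hxΘ⟩ := OCPEC.mem_constraintSet_iff.1 hxu.1
  refine hslope x u ⟨(t, x, u), subset_closure ⟨ht, hxu⟩, rfl⟩ hxU hxΘ α β σ hσ
    fun y v hv hyv => ?_
  have := hprox (WithLp.toLp 2 (y, v)) (OCPEC.mem_constraintSet_iff.2 ⟨hv, hyv⟩)
  -- In the Euclidean product the inner product and the squared norm split into the sums required by
  -- `hslope`.
  rw [WithLp.prod_inner_apply, WithLp.prod_norm_sq_eq_of_L2] at this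
  simpa using this
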